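/- Let $\theta>0$ and let $\Delta_1=\{(p_1,p_2,\ldots): p_1\ge p_2\ge\cdots\ge 0,\ \sum_i p_i=1\}$. The Poisson--Dirichlet distribution $\mathrm{PD}_\theta$ is the probability measure on $\Delta_1$ that is the law of the decreasing rearrangement of the sequence $Q_k=T_k\prod_{i<k}(1-T_i)$, $k\ge 1$, where $T_1,T_2,\ldots$ are independent $\mathrm{Beta}(1,\theta)$ random variables. Suppose that $P=(P_1,P_2,\ldots)\sim \mathrm{PD}_\theta$, and let $P_*$ be a size-biased pick from amongst $P_1,P_2,\ldots$, that is, $P_*=P_I$ almost surely, where $I$ is a random index with $\mathbb{P}(I=i\mid P)=P_i$ almost surely for every $i\ge 1$. Then $P_*\sim\mathrm{Beta}(1,\theta)$. -/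

import Mathlib

open MeasureTheory ProbabilityTheory

noncomputable section

namespace PoissonDirichlet

/-- The space of countable partitions of `[0,1]` with parts in decreasing order:
sequences `p 0 ≥ p 1 ≥ ⋯ ≥ 0` of sum `1`. -/
def Delta : Set (ℕ → ℝ) := {p | Antitone p ∧ (∀ i, 0 ≤ p i) ∧ HasSum p 1}

/-- Stick breaking: the block `k` takes the fraction `T k` of the mass that the blocks
`0, …, k - 1` have left unallocated. -/
def stick (T : ℕ → ℝ) (k : ℕ) : ℝ := T k * ∏ i ∈ Finset.range k, (1 - T i)

/-- The decreasing rearrangement of a sequence `p ≥ 0` that tends to `0`: its term `k` is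
the `(k + 1)`-st largest term of `p`, counted with multiplicity, that is, the least `t ≥ 0`
such that at most `k` terms of `p` exceed `t`. -/
def ranked (p : ℕ → ℝ) (k : ℕ) : ℝ :=
  sInf {t : ℝ | 0 ≤ t ∧ {i : ℕ | t < p i}.encard ≤ (k : ℕ∞)}

/-- The law of a sequence of independent `Beta(1, θ)` random variables. -/
def betaSequence (θ : ℝ) : Measure (ℕ → ℝ) :=
  Measure.infinitePi (fun _ : ℕ => betaMeasure 1 θ)

/-- The Poisson-Dirichlet distribution with parameter `θ > 0`, a measure on the space of
decreasing partitions: the law of the stick-breaking sequence built from independent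
`Beta(1, θ)` variables, sorted into decreasing order. The sorted sequence lies in `Delta`
almost surely, and `comap` regards its law as a measure on `Delta`. -/
def poissonDirichlet (θ : ℝ) : Measure Delta :=
  ((betaSequence θ).map (fun T => ranked (stick T))).comap Subtype.val

/-- `X` is a size-biased pick from the parts of the random partition `P`: it is the part
`P_I` with a random index `I` which, conditionally on `P`, equals `i` with probability `P_i`. -/
def IsSizeBiasedPick {Ω : Type*} [MeasurableSpace Ω] (μ : Measure Ω)
    (P : Ω → Delta) (X : Ω → ℝ) : Prop :=
  ∃ I : Ω → ℕ, Measurable I ∧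
    (∀ i : ℕ, μ[(I ⁻¹' {i}).indicator (fun _ => (1 : ℝ)) |
        MeasurableSpace.comap P inferInstance] =ᵐ[μ] fun ω => (P ω : ℕ → ℝ) i) ∧
    ∀ᵐ ω ∂μ, X ω = (P ω : ℕ → ℝ) (I ω)

end PoissonDirichlet

end

/-!
The proof compares moments. Both `X` and a `Beta(1, θ)` variable take values in `[0, 1]`, so by the
Weierstrass approximation theorem it suffices that they have the same moments
(`Measure.ext_of_moments_of_ae_mem_Icc`).

Write `X = P_I`. Conditioning on `P` replaces the event `I = i` by the weight `P_i`, so that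
`E[X ^ n] = E[∑ i, P_i ^ (n + 1)]` (`IsSizeBiasedPick.lintegral_pow`). A power sum does not see the
order of the terms: by the layer cake formula it depends only on the number of terms above each
level, and sorting preserves these numbers (`tsum_ranked_pow`). Hence the sorted parts may be
replaced by the sticks `Q_k = T_k ∏ i < k, (1 - T_i)`
(`lintegral_tsum_pow_poissonDirichlet`). By independence the sum becomes a geometric series,
`∑ k, E[Q_k ^ (n + 1)] = E[T ^ (n + 1)] ∑ k, E[(1 - T) ^ (n + 1)] ^ k`
`  = E[T ^ (n + 1)] / (1 - θ / (θ + n + 1)) = E[T ^ (n + 1)] (θ + n + 1) / (n + 1)`,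
and this is `E[T ^ n]` by the recurrence for the beta function (`lintegral_tsum_stick_pow`).

The case `n = 0` of the last identity says that the sticks have expected total length `1`. Since
the total never exceeds `1`, the sticks exhaust the unit interval almost surely
(`ae_hasSum_stick`), which is what puts the sorted sequence in `Delta`.
-/

namespace PoissonDirichlet

open Set ENNReal

/-! ### Moments of the beta distribution -/

lemma measurable_betaPDF (a b : ℝ) : Measurable (betaPDF a b) :=
  (measurable_betaPDFReal a b).ennreal_ofReal

lemma ae_betaMeasure_mem_Ioo (a b : ℝ) : ∀ᵐ x ∂betaMeasure a b, x ∈ Ioo (0 : ℝ) 1 := by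
  rw [betaMeasure, ae_withDensity_iff (measurable_betaPDF a b)]
  refine ae_of_all _ fun x hx => ?_
  by_contra h
  rw [mem_Ioo, not_and_or, not_lt, not_lt] at h
  exact hx (h.elim betaPDF_eq_zero_of_nonpos betaPDF_eq_zero_of_one_le)

/-- The density of `Beta(a, b)` times `x ^ m * (1 - x) ^ l` is a multiple of the density of
`Beta(a + m, b + l)`. -/
lemma lintegral_pow_mul_pow_betaMeasure {a b : ℝ} (ha : 0 < a) (hb : 0 < b) (m l : ℕ) :
    ∫⁻ x, ENNReal.ofReal x ^ m * ENNReal.ofReal (1 - x) ^ l ∂betaMeasure a b =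
      ENNReal.ofReal (beta (a + m) (b + l) / beta a b) := by
  have ham : 0 < a + m := by positivity
  have hbl : 0 < b + l := by positivity
  have h0 := beta_pos ha hb
  have h1 := beta_pos ham hbl
  rw [betaMeasure, lintegral_withDensity_eq_lintegral_mul _
    (measurable_betaPDF a b) (by fun_prop)]
  rw [← mul_one (ENNReal.ofReal (beta (a + m) (b + l) / beta a b)),
    ← lintegral_betaPDF_eq_one ham hbl,
    ← lintegral_const_mul _ (measurable_betaPDF (a + m) (b + l))]
  refine lintegral_congr fun x => ?_
  rw [Pi.mul_apply]
  by_cases hx : 0 < x ∧ x < 1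
  · obtain ⟨hx0, hx1⟩ := hx
    have hx1' : 0 < 1 - x := by linarith
    rw [betaPDF_of_pos_lt_one hx0 hx1, betaPDF_of_pos_lt_one hx0 hx1,
      ← ENNReal.ofReal_pow hx0.le, ← ENNReal.ofReal_pow hx1'.le,
      ← ENNReal.ofReal_mul (by positivity), ← ENNReal.ofReal_mul (by positivity),
      ← ENNReal.ofReal_mul (by positivity), add_sub_right_comm, add_sub_right_comm,
      Real.rpow_add_natCast hx0.ne', Real.rpow_add_natCast hx1'.ne']
    congr 1
    field_simp
  · rw [not_and_or, not_lt, not_lt] at hx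
    rcases hx with hx | hx
    · simp [betaPDF_eq_zero_of_nonpos hx]
    · simp [betaPDF_eq_zero_of_one_le hx]

lemma beta_one_left {b : ℝ} (hb : 0 < b) : beta 1 b = 1 / b := by
  have := (Real.Gamma_pos_of_pos hb).ne'
  rw [beta, add_comm, Real.Gamma_add_one hb.ne', Real.Gamma_one]
  field_simp

lemma beta_add_one_left {a b : ℝ} (ha : 0 < a) (hb : 0 < b) :
    beta (a + 1) b = beta a b * (a / (a + b)) := by
  have := (Real.Gamma_pos_of_pos (add_pos ha hb)).ne'
  rw [beta, beta, add_right_comm, Real.Gamma_add_one ha.ne',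
    Real.Gamma_add_one (add_pos ha hb).ne']
  field_simp

/-! ### Determination of a law on the unit interval by its moments -/

/-- Two finite measures on `ℝ` carried by `[0, 1]` with the same moments are equal: by the
Weierstrass theorem they integrate every bounded continuous function alike. -/
lemma _root_.MeasureTheory.Measure.ext_of_moments_of_ae_mem_Icc {μ ν : Measure ℝ}
    [IsFiniteMeasure μ] [IsFiniteMeasure ν] (hμ : ∀ᵐ x ∂μ, x ∈ Icc (0 : ℝ) 1)
    (hν : ∀ᵐ x ∂ν, x ∈ Icc (0 : ℝ) 1) (h : ∀ n : ℕ, ∫ x, x ^ n ∂μ = ∫ x, x ^ n ∂ν) : μ = ν := by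
  have hint {ρ : Measure ℝ} [IsFiniteMeasure ρ] (hρ : ∀ᵐ x ∂ρ, x ∈ Icc (0 : ℝ) 1) (n : ℕ) :
      Integrable (fun x : ℝ => x ^ n) ρ := by
    refine Integrable.of_bound (by fun_prop) 1 ?_
    filter_upwards [hρ] with x hx
    rw [Real.norm_of_nonneg (pow_nonneg hx.1 n)]
    exact pow_le_one₀ hx.1 hx.2
  have hintp {ρ : Measure ℝ} [IsFiniteMeasure ρ] (hρ : ∀ᵐ x ∂ρ, x ∈ Icc (0 : ℝ) 1)
      (p : Polynomial ℝ) : Integrable (fun x : ℝ => p.eval x) ρ := by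
    simp_rw [Polynomial.eval_eq_sum_range]
    exact integrable_finsetSum _ fun i _ => (hint hρ i).const_mul _
  have hpoly (p : Polynomial ℝ) : ∫ x, p.eval x ∂μ = ∫ x, p.eval x ∂ν := by
    simp_rw [Polynomial.eval_eq_sum_range]
    rw [integral_finsetSum _ fun i _ => (hint hμ i).const_mul _,
      integral_finsetSum _ fun i _ => (hint hν i).const_mul _]
    simp_rw [integral_const_mul, h]
  refine ext_of_forall_integral_eq_of_IsFiniteMeasure fun f => ?_
  have happrox {ρ : Measure ℝ} [IsFiniteMeasure ρ] (hρ : ∀ᵐ x ∂ρ, x ∈ Icc (0 : ℝ) 1)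
      {p : Polynomial ℝ} {ε : ℝ} (hp : ∀ x ∈ Icc (0 : ℝ) 1, |p.eval x - f x| < ε) :
      |∫ x, p.eval x ∂ρ - ∫ x, f x ∂ρ| ≤ ε * ρ.real univ := by
    rw [← integral_sub (hintp hρ p) (f.integrable ρ)]
    have hle : ∀ᵐ x ∂ρ, ‖p.eval x - f x‖ ≤ ε := hρ.mono fun x hx => (hp x hx).le
    exact norm_integral_le_of_norm_le_const hle
  set M := μ.real univ + ν.real univ with hM
  have hM0 : 0 ≤ M := by positivity
  refine eq_of_abs_sub_le_all fun ε hε => ?_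
  obtain ⟨p, hp⟩ := exists_polynomial_near_of_continuousOn 0 1 f f.continuous.continuousOn
    (ε / (M + 1)) (by positivity)
  have h1 := happrox hμ hp
  have h2 := happrox hν hp
  rw [hpoly p, abs_sub_comm] at h1
  calc |∫ x, f x ∂μ - ∫ x, f x ∂ν|
      ≤ |∫ x, f x ∂μ - ∫ x, p.eval x ∂ν| + |∫ x, p.eval x ∂ν - ∫ x, f x ∂ν| :=
        abs_sub_le _ _ _
    _ ≤ ε / (M + 1) * M := by rw [hM, mul_add]; exact add_le_add h1 h2
    _ ≤ ε := by
        rw [div_mul_eq_mul_div, div_le_iff₀ (by positivity)]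
        nlinarith

/-! ### Stick breaking -/

lemma sum_range_stick (T : ℕ → ℝ) (n : ℕ) :
    ∑ k ∈ Finset.range n, stick T k = 1 - ∏ i ∈ Finset.range n, (1 - T i) := by
  induction n with
  | zero => simp
  | succ n ih => rw [Finset.sum_range_succ, ih, Finset.prod_range_succ, stick]; ring

lemma stick_nonneg {T : ℕ → ℝ} (hT : ∀ i, T i ∈ Icc (0 : ℝ) 1) (k : ℕ) : 0 ≤ stick T k :=
  mul_nonneg (hT k).1 (Finset.prod_nonneg fun i _ => sub_nonneg.2 (hT i).2)

lemma sum_range_stick_le_one {T : ℕ → ℝ} (hT : ∀ i, T i ∈ Icc (0 : ℝ) 1) (n : ℕ) :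
    ∑ k ∈ Finset.range n, stick T k ≤ 1 := by
  rw [sum_range_stick, sub_le_self_iff]
  exact Finset.prod_nonneg fun i _ => sub_nonneg.2 (hT i).2

@[fun_prop]
lemma measurable_stick : Measurable stick := by
  unfold stick
  fun_prop

lemma isProbabilityMeasure_betaSequence {θ : ℝ} (hθ : 0 < θ) :
    IsProbabilityMeasure (betaSequence θ) := by
  have := isProbabilityMeasureBeta one_pos hθ
  unfold betaSequence
  infer_instance

lemma ae_betaSequence_mem_Icc {θ : ℝ} (hθ : 0 < θ) :
    ∀ᵐ T ∂betaSequence θ, ∀ i, T i ∈ Icc (0 : ℝ) 1 := by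
  have := isProbabilityMeasureBeta one_pos hθ
  refine ae_all_iff.2 fun i => ?_
  have hi := measurePreserving_eval_infinitePi (fun _ : ℕ => betaMeasure 1 θ) i
  exact hi.quasiMeasurePreserving.ae
    ((ae_betaMeasure_mem_Ioo 1 θ).mono fun x hx => Ioo_subset_Icc_self hx)

/-- The factors of the stick `k` are independent: one is `T k`, the `k` others are distributed as
`1 - T k`. -/
lemma lintegral_stick_pow {θ : ℝ} (hθ : 0 < θ) (m k : ℕ) :
    ∫⁻ T, ENNReal.ofReal (stick T k) ^ m ∂betaSequence θ =
      ENNReal.ofReal (beta (1 + m) θ / beta 1 θ) * ENNReal.ofReal (θ / (θ + m)) ^ k := by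
  have := isProbabilityMeasureBeta one_pos hθ
  -- The factor that the coordinate `i ≤ k` contributes to the stick `k`.
  set g : ℕ → ℝ → ℝ≥0∞ := fun i x =>
    if i = k then ENNReal.ofReal x ^ m else ENNReal.ofReal (1 - x) ^ m with hg
  have hgm (i : ℕ) : Measurable (g i) := by
    simp only [hg]; split_ifs <;> fun_prop
  have hgk : g k = fun x => ENNReal.ofReal x ^ m := by simp [hg]
  have hgi {i : ℕ} (hi : i ∈ Finset.range k) : g i = fun x => ENNReal.ofReal (1 - x) ^ m := by
    simp [hg, (Finset.mem_range.1 hi).ne]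
  have hprod : (fun T : ℕ → ℝ => ENNReal.ofReal (stick T k) ^ m) =ᵐ[betaSequence θ]
      fun T => ∏ i ∈ Finset.range (k + 1), g i (T i) := by
    filter_upwards [ae_betaSequence_mem_Icc hθ] with T hT
    rw [Finset.prod_range_succ, hgk, Finset.prod_congr rfl fun i hi => by rw [hgi hi], stick,
      ENNReal.ofReal_mul (hT k).1, ENNReal.ofReal_prod_of_nonneg fun i _ => sub_nonneg.2 (hT i).2,
      mul_pow, Finset.prod_pow, mul_comm]
  have heval (i : ℕ) : ∫⁻ T, g i (T i) ∂betaSequence θ = ∫⁻ x, g i x ∂betaMeasure 1 θ :=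
    (measurePreserving_eval_infinitePi (fun _ : ℕ => betaMeasure 1 θ) i).lintegral_comp (hgm i)
  have hT := lintegral_pow_mul_pow_betaMeasure one_pos hθ m 0
  have hR := lintegral_pow_mul_pow_betaMeasure one_pos hθ 0 m
  simp only [pow_zero, mul_one, one_mul, Nat.cast_zero, add_zero] at hT hR
  have hbeta : beta 1 (θ + m) / beta 1 θ = θ / (θ + m) := by
    rw [beta_one_left hθ, beta_one_left (by positivity)]
    field_simp
  have hindep : iIndepFun (fun i (T : ℕ → ℝ) => g i (T i)) (betaSequence θ) :=
    iIndepFun_infinitePi hgm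
  rw [lintegral_congr_ae hprod,
    lintegral_prod_eq_prod_lintegral_of_indepFun _ _ hindep
      (fun i => (hgm i).comp (measurable_pi_apply i)),
    Finset.prod_range_succ, mul_comm, heval, hgk, hT,
    Finset.prod_congr rfl fun i hi => by rw [heval, hgi hi, hR], Finset.prod_const,
    Finset.card_range, hbeta]

/-- Summing the moments of order `n + 1` of the sticks over `k` gives a geometric series with ratio
`θ / (θ + n + 1)`; the beta recurrence turns its value into the moment of order `n` of
`Beta(1, θ)`. -/
lemma lintegral_tsum_stick_pow {θ : ℝ} (hθ : 0 < θ) (n : ℕ) :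
    ∫⁻ T, ∑' k, ENNReal.ofReal (stick T k) ^ (n + 1) ∂betaSequence θ =
      ∫⁻ x, ENNReal.ofReal x ^ n ∂betaMeasure 1 θ := by
  have hn := lintegral_pow_mul_pow_betaMeasure one_pos hθ n 0
  simp only [pow_zero, mul_one, Nat.cast_zero, add_zero] at hn
  have hm : (0 : ℝ) < (n + 1 : ℕ) := by positivity
  have h1 := beta_pos one_pos hθ
  have hgeom : 1 - ENNReal.ofReal (θ / (θ + (n + 1 : ℕ))) =
      ENNReal.ofReal ((n + 1 : ℕ) / (θ + (n + 1 : ℕ))) := by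
    rw [← ENNReal.ofReal_one, ← ENNReal.ofReal_sub _ (by positivity)]
    congr 1
    field_simp
    ring
  rw [lintegral_tsum fun k => by fun_prop]
  simp_rw [lintegral_stick_pow hθ]
  rw [ENNReal.tsum_mul_left, ENNReal.tsum_geometric, hgeom, hn,
    ← ENNReal.ofReal_inv_of_pos (by positivity), ← ENNReal.ofReal_mul (by
      have := beta_pos (add_pos one_pos hm) hθ
      positivity)]
  congr 1
  rw [Nat.cast_succ, ← add_assoc, beta_add_one_left (by positivity) hθ]
  field_simp
  ring

/-- The total length of the sticks is at most `1` and has expectation `1`. -/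
lemma ae_hasSum_stick {θ : ℝ} (hθ : 0 < θ) :
    ∀ᵐ T ∂betaSequence θ, HasSum (stick T) 1 := by
  have := isProbabilityMeasure_betaSequence hθ
  have := isProbabilityMeasureBeta one_pos hθ
  have hint : ∫⁻ T, ∑' k, ENNReal.ofReal (stick T k) ∂betaSequence θ = 1 := by
    simpa using lintegral_tsum_stick_pow hθ 0
  have hle : (fun T => ∑' k, ENNReal.ofReal (stick T k)) ≤ᵐ[betaSequence θ] fun _ => 1 := by
    filter_upwards [ae_betaSequence_mem_Icc hθ] with T hT
    refine ENNReal.tsum_le_of_sum_range_le fun n => ?_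
    rw [← ENNReal.ofReal_sum_of_nonneg fun k _ => stick_nonneg hT k, ← ENNReal.ofReal_one]
    exact ENNReal.ofReal_le_ofReal (sum_range_stick_le_one hT n)
  have heq := ae_eq_of_ae_le_of_lintegral_le hle (by simp [hint]) (by fun_prop) (by simp [hint])
  filter_upwards [ae_betaSequence_mem_Icc hθ, heq] with T hT hsum
  have hs : Summable (stick T) :=
    summable_of_sum_range_le (stick_nonneg hT) (sum_range_stick_le_one hT)
  rw [← ENNReal.ofReal_tsum_of_nonneg (stick_nonneg hT) hs, ENNReal.ofReal_eq_one] at hsum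
  exact hsum ▸ hs.hasSum

/-! ### Decreasing rearrangement -/

lemma natCast_lt_encard_iff (s : Set ℕ) (k : ℕ) :
    (k : ℕ∞) < s.encard ↔ ∃ u : Finset ℕ, u.card = k + 1 ∧ ∀ i ∈ u, i ∈ s := by
  constructor
  · intro h
    obtain ⟨v, hv, hcard⟩ := exists_subset_encard_eq (Order.add_one_le_of_lt h)
    have hfin : v.Finite := finite_of_encard_eq_coe (k := k + 1) (by simpa using hcard)
    refine ⟨hfin.toFinset, ?_, fun i hi => hv (hfin.mem_toFinset.1 hi)⟩
    rw [hfin.encard_eq_coe_toFinset_card] at hcard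
    exact_mod_cast hcard
  · rintro ⟨u, hu, hus⟩
    refine lt_of_lt_of_le ?_ (encard_le_encard (s := (u : Set ℕ)) hus)
    rw [encard_coe_eq_coe_finsetCard, hu]
    exact_mod_cast k.lt_succ_self

/-- A level `t ≥ 0` lies below the `k`-th ranked term of a bounded sequence exactly if more than
`k` terms of the sequence exceed it. Boundedness makes the set under the infimum in `ranked`
nonempty. -/
lemma lt_ranked_iff {p : ℕ → ℝ} (hp : BddAbove (range p)) {t : ℝ} (ht : 0 ≤ t) (k : ℕ) :
    t < ranked p k ↔ (k : ℕ∞) < {i : ℕ | t < p i}.encard := by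
  constructor
  · intro h
    by_contra! hle
    exact h.not_ge (csInf_le ⟨0, fun _ hs => hs.1⟩ ⟨ht, hle⟩)
  · intro h
    obtain ⟨u, hcard, hu⟩ := (natCast_lt_encard_iff _ k).1 h
    -- The least of `k + 1` terms above `t` is a lower bound for the levels defining `ranked p k`.
    obtain ⟨j, hj, hmin⟩ := u.exists_min_image p (Finset.card_pos.1 (hcard ▸ k.succ_pos))
    refine (hu j hj : t < p j).trans_le (le_csInf ?_ fun r hr => ?_)
    · obtain ⟨M, hM⟩ := hp
      refine ⟨max M 0, le_max_right _ _, ?_⟩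
      have : {i : ℕ | max M 0 < p i} = ∅ :=
        eq_empty_of_forall_notMem fun i hi =>
          absurd (hM (mem_range_self i)) (not_le.2 ((le_max_left _ _).trans_lt hi))
      rw [this, encard_empty]
      exact zero_le
    · by_contra! hlt
      exact ((natCast_lt_encard_iff _ k).2
        ⟨u, hcard, fun i hi => hlt.trans_le (hmin i hi)⟩).not_ge hr.2

lemma ranked_nonneg (p : ℕ → ℝ) (k : ℕ) : 0 ≤ ranked p k :=
  Real.sInf_nonneg fun _ h => h.1

lemma encard_setOf_natCast_lt (N : ℕ∞) : {k : ℕ | (k : ℕ∞) < N}.encard = N := by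
  induction N using ENat.recTopCoe with
  | top => simp [encard_univ]
  | coe n =>
    have : {k : ℕ | (k : ℕ∞) < n} = (Finset.range n : Set ℕ) := by ext; simp
    rw [this, encard_coe_eq_coe_finsetCard, Finset.card_range]

lemma encard_lt_ranked {p : ℕ → ℝ} (hp : BddAbove (range p)) {t : ℝ} (ht : 0 ≤ t) :
    {k : ℕ | t < ranked p k}.encard = {i : ℕ | t < p i}.encard := by
  simp_rw [lt_ranked_iff hp ht, encard_setOf_natCast_lt]

lemma antitone_ranked {p : ℕ → ℝ} (hp : BddAbove (range p)) : Antitone (ranked p) := by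
  intro k l hkl
  by_contra! h
  have hk := ranked_nonneg p k
  exact ((lt_ranked_iff hp hk k).2
    ((Nat.cast_le.2 hkl).trans_lt ((lt_ranked_iff hp hk l).1 h))).false

/-- Ranking preserves power sums: by the layer cake formula for the counting measure they depend
only on the number of terms above each level. -/
lemma tsum_ranked_pow {p : ℕ → ℝ} (hp : BddAbove (range p)) (hp0 : ∀ i, 0 ≤ p i) (n : ℕ) :
    ∑' k, ENNReal.ofReal (ranked p k) ^ (n + 1) = ∑' i, ENNReal.ofReal (p i) ^ (n + 1) := by
  have key {q : ℕ → ℝ} (hq : ∀ i, 0 ≤ q i) : ∑' i, ENNReal.ofReal (q i) ^ (n + 1) =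
      ENNReal.ofReal ((n + 1 : ℕ) : ℝ) * ∫⁻ t in Ioi (0 : ℝ), Measure.count {i : ℕ | t < q i} *
        ENNReal.ofReal (t ^ (((n + 1 : ℕ) : ℝ) - 1)) := by
    rw [← lintegral_rpow_eq_lintegral_meas_lt_mul Measure.count (ae_of_all _ hq)
      measurable_from_nat.aemeasurable (by positivity), lintegral_count]
    simp_rw [Real.rpow_natCast, ENNReal.ofReal_pow (hq _)]
  rw [key (ranked_nonneg p), key hp0]
  congr 1
  refine setLIntegral_congr_fun measurableSet_Ioi fun t ht => ?_
  simp only [Measure.count_apply .of_discrete, encard_lt_ranked hp (le_of_lt ht)]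

lemma ranked_mem_Delta {p : ℕ → ℝ} (hp0 : ∀ i, 0 ≤ p i) (hp : HasSum p 1) :
    ranked p ∈ Delta := by
  have hb : BddAbove (range p) :=
    ⟨1, forall_mem_range.2 fun i => le_hasSum hp i fun j _ => hp0 j⟩
  refine ⟨antitone_ranked hb, ranked_nonneg p, ?_⟩
  have h := tsum_ranked_pow hb hp0 0
  simp only [zero_add, pow_one] at h
  rw [← ENNReal.ofReal_tsum_of_nonneg hp0 hp.summable, hp.tsum_eq] at h
  have hs : Summable (ranked p) := by
    have := ENNReal.summable_toReal (f := fun k => ENNReal.ofReal (ranked p k)) (by simp [h])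
    simpa only [ENNReal.toReal_ofReal (ranked_nonneg p _)] using this
  rw [← ENNReal.ofReal_tsum_of_nonneg (ranked_nonneg p) hs,
    ENNReal.ofReal_eq_ofReal_iff (tsum_nonneg (ranked_nonneg p)) zero_le_one] at h
  exact h ▸ hs.hasSum

lemma measurableSet_Delta : MeasurableSet Delta := by
  have h : Delta = {p : ℕ → ℝ | Antitone p} ∩ ({p | ∀ i, 0 ≤ p i} ∩
      {p | Filter.Tendsto (fun n => ∑ i ∈ Finset.range n, p i) Filter.atTop (nhds 1)}) := by
    ext p
    -- For nonnegative terms `HasSum` is convergence of the partial sums, a measurable condition.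
    refine and_congr_right fun _ => and_congr_right fun h0 => ?_
    exact hasSum_iff_tendsto_nat_of_nonneg h0 1
  rw [h]
  refine .inter ?_ (.inter ?_ ?_)
  · simp only [Antitone, ofPred_forall]
    exact .iInter fun i => .iInter fun j => .iInter fun _ =>
      measurableSet_le (measurable_pi_apply j) (measurable_pi_apply i)
  · simp only [ofPred_forall]
    exact .iInter fun i => measurableSet_le measurable_const (measurable_pi_apply i)
  · exact measurableSet_tendsto _ fun n => by fun_prop

/-- For a sequence unbounded above the infimum defining `ranked` is over the empty set, so
all ranked terms have the junk value `0`. -/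
lemma bddAbove_range_of_lt_ranked {p : ℕ → ℝ} {t : ℝ} (ht : 0 ≤ t) {k : ℕ}
    (h : t < ranked p k) : BddAbove (range p) := by
  rcases eq_empty_or_nonempty {r : ℝ | 0 ≤ r ∧ {i : ℕ | r < p i}.encard ≤ (k : ℕ∞)} with he | hne
  · rw [ranked, he, Real.sInf_empty] at h
    exact absurd h ht.not_gt
  · obtain ⟨r, _, hr⟩ := hne
    have hfin : {i : ℕ | r < p i}.Finite := finite_of_encard_le_coe hr
    refine ((hfin.image p).bddAbove.union (bddAbove_Iic (a := r))).mono ?_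
    rintro _ ⟨i, rfl⟩
    exact (lt_or_ge r (p i)).imp (fun hi => ⟨i, hi, rfl⟩) id

lemma measurable_ranked : Measurable ranked := by
  refine measurable_pi_iff.2 fun k => measurable_of_Ioi fun t => ?_
  rcases lt_or_ge t 0 with ht | ht
  · convert! MeasurableSet.univ
    exact eq_univ_of_forall fun p => ht.trans_le (ranked_nonneg p k)
  · have h : (fun p => ranked p k) ⁻¹' Ioi t = {p : ℕ → ℝ | BddAbove (range p)} ∩
        ⋃ u ∈ {u : Finset ℕ | u.card = k + 1}, ⋂ i ∈ u, {p : ℕ → ℝ | t < p i} := by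
      ext p
      simp only [mem_preimage, mem_Ioi, mem_inter_iff, mem_ofPred_eq, mem_iUnion, mem_iInter,
        exists_prop]
      constructor
      · intro hp
        have hb := bddAbove_range_of_lt_ranked ht hp
        exact ⟨hb, (natCast_lt_encard_iff _ k).1 ((lt_ranked_iff hb ht k).1 hp)⟩
      · rintro ⟨hb, hu⟩
        exact (lt_ranked_iff hb ht k).2 ((natCast_lt_encard_iff _ k).2 hu)
    rw [h]
    refine .inter (measurableSet_bddAbove_range fun i => measurable_pi_apply i) ?_
    exact .biUnion (to_countable _) fun u _ => u.measurableSet_biInter fun i _ =>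
      measurableSet_lt measurable_const (measurable_pi_apply i)

/-! ### The Poisson-Dirichlet distribution -/

/-- The Poisson-Dirichlet distribution assigns to power sums the value they have on the unranked
sticks. The sorted sticks lie in `Delta` almost surely, so `comap` loses no mass. -/
lemma lintegral_tsum_pow_poissonDirichlet {θ : ℝ} (hθ : 0 < θ) (n : ℕ) :
    ∫⁻ p : Delta, ∑' i, ENNReal.ofReal ((p : ℕ → ℝ) i) ^ (n + 1) ∂poissonDirichlet θ =
      ∫⁻ T, ∑' k, ENNReal.ofReal (stick T k) ^ (n + 1) ∂betaSequence θ := by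
  have hm : Measurable fun T => ranked (stick T) := measurable_ranked.comp measurable_stick
  have hF : Measurable fun q : ℕ → ℝ => ∑' i, ENNReal.ofReal (q i) ^ (n + 1) := by fun_prop
  have hae := ae_hasSum_stick hθ
  have hT := ae_betaSequence_mem_Icc hθ
  have hmem : ∀ᵐ q ∂(betaSequence θ).map (fun T => ranked (stick T)), q ∈ Delta := by
    refine (ae_map_iff hm.aemeasurable measurableSet_Delta).2 ?_
    filter_upwards [hae, hT] with T h1 h2
    exact ranked_mem_Delta (stick_nonneg h2) h1
  rw [poissonDirichlet, ← (MeasurableEmbedding.subtype_coe measurableSet_Delta).lintegral_map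
    (fun q : ℕ → ℝ => ∑' i, ENNReal.ofReal (q i) ^ (n + 1)),
    map_comap_subtype_coe measurableSet_Delta, Measure.restrict_eq_self_of_ae_mem hmem,
    lintegral_map hF hm]
  refine lintegral_congr_ae ?_
  filter_upwards [hae, hT] with T h1 h2
  exact tsum_ranked_pow ⟨1, forall_mem_range.2 fun i => le_hasSum h1 i fun j _ =>
    stick_nonneg h2 j⟩ (stick_nonneg h2) n

/-! ### Size-biased picks -/

lemma Delta.le_one (p : Delta) (i : ℕ) : (p : ℕ → ℝ) i ≤ 1 :=
  le_hasSum p.2.2.2 i fun j _ => p.2.2.1 j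

lemma Delta.measurable_apply (i : ℕ) : Measurable fun p : Delta => (p : ℕ → ℝ) i :=
  (measurable_pi_apply i).comp measurable_subtype_coe

variable {Ω : Type*} [MeasurableSpace Ω] {μ : Measure Ω} {P : Ω → Delta} {X : Ω → ℝ}

lemma IsSizeBiasedPick.aemeasurable (hX : IsSizeBiasedPick μ P X) (hP : Measurable P) :
    AEMeasurable X μ := by
  obtain ⟨I, hI, -, hXI⟩ := hX
  have hm : Measurable fun q : Delta × ℕ => (q.1 : ℕ → ℝ) q.2 :=
    measurable_from_prod_countable_left fun i => Delta.measurable_apply i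
  exact ⟨_, hm.comp (hP.prodMk hI), hXI⟩

lemma IsSizeBiasedPick.ae_mem_Icc (hX : IsSizeBiasedPick μ P X) :
    ∀ᵐ ω ∂μ, X ω ∈ Icc (0 : ℝ) 1 := by
  obtain ⟨I, -, -, hXI⟩ := hX
  filter_upwards [hXI] with ω h
  rw [h]
  exact ⟨(P ω).2.2.1 _, Delta.le_one (P ω) _⟩

/-- The event `I = i` weighs functions of `P` as the density `P_i` does. -/
lemma setLIntegral_pow_of_condExp_eq [IsProbabilityMeasure μ] (hP : Measurable P) {A : Set Ω}
    (hA : MeasurableSet A) {i : ℕ}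
    (h : μ[A.indicator (fun _ => (1 : ℝ)) | MeasurableSpace.comap P inferInstance] =ᵐ[μ]
      fun ω => (P ω : ℕ → ℝ) i) (n : ℕ) :
    ∫⁻ ω in A, ENNReal.ofReal ((P ω : ℕ → ℝ) i) ^ n ∂μ =
      ∫⁻ ω, ENNReal.ofReal ((P ω : ℕ → ℝ) i) ^ (n + 1) ∂μ := by
  have hm : MeasurableSpace.comap P inferInstance ≤ ‹MeasurableSpace Ω› := hP.comap_le
  set g : Ω → ℝ := fun ω => (P ω : ℕ → ℝ) i with hg
  have hg0 (ω : Ω) : 0 ≤ g ω := (P ω).2.2.1 i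
  have hgm : Measurable[MeasurableSpace.comap P inferInstance] g :=
    (Delta.measurable_apply i).comp (comap_measurable P)
  have hgm' : Measurable g := hgm.mono hm le_rfl
  have hgint (m : ℕ) : Integrable (fun ω => g ω ^ m) μ := by
    refine Integrable.of_bound (by fun_prop) 1 (ae_of_all _ fun ω => ?_)
    rw [Real.norm_of_nonneg (pow_nonneg (hg0 ω) m)]
    exact pow_le_one₀ (hg0 ω) (Delta.le_one (P ω) i)
  have hmul : ((fun ω => g ω ^ n) * A.indicator fun _ => (1 : ℝ)) =
      A.indicator fun ω => g ω ^ n := by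
    ext ω
    by_cases hω : ω ∈ A <;> simp [hω]
  have hreal : ∫ ω in A, g ω ^ n ∂μ = ∫ ω, g ω ^ (n + 1) ∂μ := by
    rw [← integral_indicator hA, ← hmul, ← integral_condExp hm]
    refine integral_congr_ae ?_
    filter_upwards [condExp_mul_of_stronglyMeasurable_left (hgm.pow_const n).stronglyMeasurable
      (hmul ▸ (hgint n).indicator hA) ((integrable_const 1).indicator hA), h] with ω h1 h2
    rw [h1, Pi.mul_apply, h2, pow_succ]
  have hofReal (ω : Ω) (m : ℕ) :
      ENNReal.ofReal ((P ω : ℕ → ℝ) i) ^ m = ENNReal.ofReal (g ω ^ m) :=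
    (ENNReal.ofReal_pow (hg0 ω) m).symm
  simp_rw [hofReal]
  rw [← ofReal_integral_eq_lintegral_ofReal (hgint n).integrableOn
      (ae_of_all _ fun ω => pow_nonneg (hg0 ω) n),
    ← ofReal_integral_eq_lintegral_ofReal (hgint (n + 1))
      (ae_of_all _ fun ω => pow_nonneg (hg0 ω) (n + 1)), hreal]

/-- Moments of a size-biased pick are expected power sums, with the exponent raised by one. -/
lemma IsSizeBiasedPick.lintegral_pow [IsProbabilityMeasure μ] (hX : IsSizeBiasedPick μ P X)
    (hP : Measurable P) (n : ℕ) :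
    ∫⁻ ω, ENNReal.ofReal (X ω) ^ n ∂μ =
      ∫⁻ ω, ∑' i, ENNReal.ofReal ((P ω : ℕ → ℝ) i) ^ (n + 1) ∂μ := by
  obtain ⟨I, hI, hcond, hXI⟩ := hX
  have hA (i : ℕ) : MeasurableSet (I ⁻¹' {i}) := hI (measurableSet_singleton i)
  have hPi (i : ℕ) : Measurable fun ω => (P ω : ℕ → ℝ) i := (Delta.measurable_apply i).comp hP
  rw [lintegral_tsum fun i => by fun_prop, ← setLIntegral_univ,
    ← iUnion_eq_univ_iff.2 (fun ω => ⟨I ω, rfl⟩ : ∀ ω, ∃ i, ω ∈ I ⁻¹' {i}),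
    lintegral_iUnion hA fun i j hij => (disjoint_singleton.2 hij).preimage I]
  refine tsum_congr fun i => ?_
  rw [← setLIntegral_pow_of_condExp_eq hP (hA i) (hcond i) n]
  refine lintegral_congr_ae ((ae_restrict_iff' (hA i)).2 ?_)
  filter_upwards [hXI] with ω h hω
  rw [h, show I ω = i from hω]

end PoissonDirichlet


theorem mainTheorem10 {Ω : Type*} [MeasurableSpace Ω] (μ : Measure Ω) [IsProbabilityMeasure μ]
    (θ : ℝ) (hθ : 0 < θ) (P : Ω → PoissonDirichlet.Delta) (hPm : Measurable P)
    (hP : HasLaw P (PoissonDirichlet.poissonDirichlet θ) μ)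
    (X : Ω → ℝ) (hX : PoissonDirichlet.IsSizeBiasedPick μ P X) :
    HasLaw X (betaMeasure 1 θ) μ := by
  have hXm := hX.aemeasurable hPm
  have := isProbabilityMeasureBeta one_pos hθ
  have := Measure.isProbabilityMeasure_map hXm
  have hXmem : ∀ᵐ x ∂μ.map X, x ∈ Set.Icc (0 : ℝ) 1 :=
    (ae_map_iff hXm measurableSet_Icc).2 hX.ae_mem_Icc
  have hβmem : ∀ᵐ x ∂betaMeasure 1 θ, x ∈ Set.Icc (0 : ℝ) 1 :=
    (PoissonDirichlet.ae_betaMeasure_mem_Ioo 1 θ).mono fun x hx => Set.Ioo_subset_Icc_self hx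
  have hF (n : ℕ) : Measurable fun p : PoissonDirichlet.Delta =>
      ∑' i, ENNReal.ofReal ((p : ℕ → ℝ) i) ^ (n + 1) :=
    .tsum fun i => (PoissonDirichlet.Delta.measurable_apply i).ennreal_ofReal.pow_const _
  have hmom (n : ℕ) : ∫⁻ x, ENNReal.ofReal x ^ n ∂μ.map X =
      ∫⁻ x, ENNReal.ofReal x ^ n ∂betaMeasure 1 θ := by
    rw [lintegral_map' (by fun_prop) hXm, hX.lintegral_pow hPm, ← lintegral_map (hF n) hPm,
      hP.map_eq, PoissonDirichlet.lintegral_tsum_pow_poissonDirichlet hθ,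
      PoissonDirichlet.lintegral_tsum_stick_pow hθ]
  have hint {ν : Measure ℝ} (hν : ∀ᵐ x ∂ν, x ∈ Set.Icc (0 : ℝ) 1) (n : ℕ) :
      ∫ x, x ^ n ∂ν = (∫⁻ x, ENNReal.ofReal x ^ n ∂ν).toReal := by
    rw [integral_eq_lintegral_of_nonneg_ae (hν.mono fun x hx => pow_nonneg hx.1 n)
      (by fun_prop)]
    congr 1
    exact lintegral_congr_ae (hν.mono fun x hx => ENNReal.ofReal_pow hx.1 n)
  refine ⟨hXm, Measure.ext_of_moments_of_ae_mem_Icc hXmem hβmem fun n => ?_⟩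
  rw [hint hXmem, hint hβmem, hmom]
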